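/- Notation. $e(x)=e^{2\pi i x}$; $n(u_{12},u_{13},u_{23})$ is the upper triangular unipotent $3\times3$ matrix with these entries; $t(y_0,y_1)=\mathrm{diag}(y_0y_1,y_0,1)$; $\mathfrak h^3=GL_3(\mathbb R)/(O_3(\mathbb R)\mathbb R^\times)=\{n(u)\,t(y_0,y_1): u_{ij}\in\mathbb R,\ y_0,y_1>0\}$. An automorphic function of $SL_3(\mathbb Z)$ is a smooth left $SL_3(\mathbb Z)$-invariant function $\Phi:\mathfrak h^3\to\mathbb C$, and its Fourier–Whittaker periods are $$\widehat\Phi_{(m_1,m_2)}(g)=\int_0^1\!\!\int_0^1\!\!\int_0^1\Phi\bigl(n(u_{12},u_{13},u_{23})\,g\bigr)\,e(-m_1u_{23}-m_2u_{12})\,du_{12}\,du_{13}\,du_{23}.$$ (A) Let $\Phi$ be an automorphic function of $SL_3(\mathbb Z)$ and $y_0,y_1>0$. Then $$\int_0^1\Phi\bigl(n(u,0,0)\,t(y_0,y_1)\bigr)e(-u)\,du=\sum_{a_0\in\mathbb Z}\ \sum_{a_1\in\mathbb Z}\widehat\Phi_{(a_1,1)}\left(\begin{pmatrix}1&&\\&1&\\&-a_0&1\end{pmatrix}t(y_0,y_1)\right),$$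 where for every $a_0$ the inner sum over $a_1$ converges absolutely, and then the outer sum over $a_0$ converges absolutely. (B) Let $\Phi$ be a Maass cusp form of $SL_3(\mathbb Z)$: a cuspidal automorphic function in $L^2(SL_3(\mathbb Z)\backslash\mathfrak h^3)$ for which there is $\alpha=(\alpha_1,\alpha_2,\alpha_3)\in\mathbb C^3$ with $\alpha_1+\alpha_2+\alpha_3=0$ (its Langlands parameters) such that every $D$ in the center of the universal enveloping algebra of $\mathfrak{gl}_3(\mathbb C)$ acts on $\Phi$ and on $I_\alpha\bigl(n(u)t(y_0,y_1)\bigr)=y_0^{1-\alpha_3}y_1^{1+\alpha_1}$ by the same scalar. Let $W_\alpha(y_0,y_1)$ be the completed Whittaker function, i.e. the analytic continuation in $\alpha$ (from $\mathrm{Re}\,\alpha_1>\mathrm{Re}\,\alpha_2>\mathrm{Re}\,\alpha_3$) of $$\prod_{1\le j<k\le3}\Gamma_{\mathbb R}(1+\alpha_j-\alpha_k)\int_{\mathbb R^3}I_\alpha\left[\begin{pmatrix}&&1\\&-1&\\1&&\end{pmatrix}n(u_{12},u_{13},u_{23})\,t(y_0,y_1)\right]e(-u_{12}-u_{23})\,du_{12}\,du_{13}\,du_{23},$$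 where $\Gamma_{\mathbb R}(s)=\pi^{-s/2}\Gamma(s/2)$. For nonzero integers $m_1,m_2$ the Fourier coefficient $\mathcal B_\Phi(m_1,m_2)$ is the complex number with $\widehat\Phi_{(m_1,m_2)}(t(y_0,y_1))=\frac{\mathcal B_\Phi(m_1,m_2)}{|m_1m_2|}W_\alpha(|m_1|y_0,|m_2|y_1)$ for all $y_0,y_1>0$. Suppose that $\Phi$ is Hecke-normalized, i.e. an eigenfunction of all Hecke operators $T_n$ $(n\ge1)$ with $\mathcal B_\Phi(1,1)=1$. Then for all $y_0,y_1>0$ $$\int_0^1\Phi\bigl(n(u,0,0)\,t(y_0,y_1)\bigr)e(-u)\,du=\sum_{a_1\ne0}\frac{\mathcal B_\Phi(a_1,1)}{|a_1|}W_\alpha(|a_1|y_0,y_1)$$ $$\qquad+\sum_{a_0\ne0}\ \sum_{a_1\ne0}\frac{\mathcal B_\Phi(a_1,1)}{|a_1|}\,W_\alpha\!\left(\frac{|a_1|y_0}{1+(a_0y_0)^2},\,y_1\sqrt{1+(a_0y_0)^2}\right)e\!\left(-\frac{a_0a_1y_0^2}{1+(a_0y_0)^2}\right),$$ where $a_0,a_1$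 run over nonzero integers, the sum over $a_1$ in the first line converges absolutely, and in the second line the inner sum over $a_1$ and then the outer sum over $a_0$ converge absolutely. -/

import Mathlib

open scoped ContDiff

noncomputable section

namespace GL3

/-- Real `3 × 3` matrices. A function on the generalized upper half plane
`𝔥³ = GL₃(ℝ) / (O₃(ℝ) · ℝˣ)` is represented by a right `O₃(ℝ) · ℝˣ`-invariant function
on invertible matrices; values at singular matrices are never used. -/
abbrev Mat : Type := Matrix (Fin 3) (Fin 3) ℝ

/-- `e(x) = exp(2πix)`. -/
def e (x : ℝ) : ℂ := Complex.exp (2 * Real.pi * Complex.I * x)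

/-- The upper triangular unipotent matrix with entries `u₁₂, u₁₃, u₂₃`. -/
def upper (u12 u13 u23 : ℝ) : Mat := !![1, u12, u13; 0, 1, u23; 0, 0, 1]

/-- The lower triangular unipotent matrix with `(3,2)` entry `x`. -/
def lower32 (x : ℝ) : Mat := !![1, 0, 0; 0, 1, 0; 0, x, 1]

/-- `diag(y₀y₁, y₀, 1)`. -/
def torus (y0 y1 : ℝ) : Mat := !![y0 * y1, 0, 0; 0, y0, 0; 0, 0, 1]

/-! ### Automorphic functions -/

/-- A smooth function on `𝔥³` that is invariant under `SL₃(ℤ)`. -/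
structure IsAutomorphicFunction (Φ : Mat → ℂ) : Prop where
  left_inv : ∀ (γ : Matrix.SpecialLinearGroup (Fin 3) ℤ) (g : Mat), g.det ≠ 0 →
    Φ (γ.1.map (fun n : ℤ => (n : ℝ)) * g) = Φ g
  right_orthogonal : ∀ g k : Mat, g.det ≠ 0 → k ∈ Matrix.orthogonalGroup (Fin 3) ℝ →
    Φ (g * k) = Φ g
  scalar_inv : ∀ (r : ℝ) (g : Mat), r ≠ 0 → g.det ≠ 0 → Φ (r • g) = Φ g
  smooth : ContDiffOn ℝ ∞ (fun x : Fin 3 → Fin 3 → ℝ => Φ (Matrix.of x))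
    {x | (Matrix.of x).det ≠ 0}

/-- The Fourier-Whittaker period `(Φ^)_(m₁,m₂)(g)`: the integral of
`Φ(n(u) g) e(-m₁ u₂₃ - m₂ u₁₂)` over `u₁₂, u₁₃, u₂₃ ∈ [0,1]`. -/
def period (Φ : Mat → ℂ) (m1 m2 : ℤ) (g : Mat) : ℂ :=
  ∫ u23 in (0 : ℝ)..1, ∫ u13 in (0 : ℝ)..1, ∫ u12 in (0 : ℝ)..1,
    Φ (upper u12 u13 u23 * g) * e (-(m1 * u23) - m2 * u12)

/-- The incomplete unipotent integral `∫₀¹ Φ(n(u₁₂) diag(y₀y₁, y₀, 1)) e(-u₁₂) du₁₂`. -/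
def incompleteIntegral (Φ : Mat → ℂ) (y0 y1 : ℝ) : ℂ :=
  ∫ u12 in (0 : ℝ)..1, Φ (upper u12 0 0 * torus y0 y1) * e (-u12)

/-! ### The function `I_α` and the Whittaker function -/

/-- `‖row₃‖²`. For `g = r · n · diag(y₀y₁, y₀, 1) · k` (Iwasawa) this is `r²`. -/
def bottomSq (g : Mat) : ℝ := g 2 ⬝ᵥ g 2

/-- `‖row₂ ∧ row₃‖²`. For `g = r · n · diag(y₀y₁, y₀, 1) · k` this is `r⁴ y₀²`. -/
def wedgeSq (g : Mat) : ℝ := (g 1 ⬝ᵥ g 1) * (g 2 ⬝ᵥ g 2) - (g 1 ⬝ᵥ g 2) ^ 2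

/-- The Iwasawa coordinate `y₀` of an invertible matrix. -/
def iwasawaY0 (g : Mat) : ℝ := Real.sqrt (wedgeSq g) / bottomSq g

/-- The Iwasawa coordinate `y₁` of an invertible matrix; here `|det g| = |r|³ y₀² y₁`. -/
def iwasawaY1 (g : Mat) : ℝ := |g.det| * Real.sqrt (bottomSq g) / wedgeSq g

/-- `I_α = y₀^(1 - α₃) y₁^(1 + α₁)` as a function on invertible matrices
(`α 0, α 1, α 2` are `α₁, α₂, α₃`). -/
def powerFn (α : Fin 3 → ℂ) (g : Mat) : ℂ :=
  (iwasawaY0 g : ℂ) ^ (1 - α 2) * (iwasawaY1 g : ℂ) ^ (1 + α 0)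

/-- The long Weyl element. -/
def longWeyl : Mat := !![0, 0, 1; 0, -1, 0; 1, 0, 0]

/-- The completed Jacquet integral. It converges absolutely when
`Re α₁ > Re α₂ > Re α₃`. -/
def jacquet (α : Fin 3 → ℂ) (y0 y1 : ℝ) : ℂ :=
  Complex.Gammaℝ (1 + α 0 - α 1) * Complex.Gammaℝ (1 + α 0 - α 2) *
    Complex.Gammaℝ (1 + α 1 - α 2) *
    ∫ u23 : ℝ, ∫ u13 : ℝ, ∫ u12 : ℝ,
      powerFn α (longWeyl * upper u12 u13 u23 * torus y0 y1) * e (-u12 - u23)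

/-- `F` is an entire function of `(α₁, α₂)` (with `α₃ = -α₁ - α₂`) that continues the
completed Jacquet integral from its domain of absolute convergence. -/
def ContinuesJacquet (y0 y1 : ℝ) (F : ℂ × ℂ → ℂ) : Prop :=
  Differentiable ℂ F ∧ ∀ s t : ℂ, t.re < s.re → (-s - t).re < t.re →
    F (s, t) = jacquet ![s, t, -s - t] y0 y1

open Classical in
/-- The (completed, spherical) Whittaker function `W_α(y₀, y₁)` of `GL₃(ℝ)`, for
`α₁ + α₂ + α₃ = 0`: the value at `α` of the analytic continuation of the completed Jacquet
integral (unique by the identity theorem). -/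
def whittaker (α : Fin 3 → ℂ) (y0 y1 : ℝ) : ℂ :=
  if h : ∃ F : ℂ × ℂ → ℂ, ContinuesJacquet y0 y1 F then h.choose (α 0, α 1) else 0

/-! ### Invariant differential operators -/

attribute [local instance] LieRing.ofAssociativeRing

/-- The left-invariant derivation of the elementary matrix `E_ij`:
`(D_ij f)(g) = d/dt f(g (1 + t E_ij))` at `t = 0`. -/
def deriv1 (p : Fin 3 × Fin 3) (f : Mat → ℂ) (g : Mat) : ℂ :=
  deriv (fun t : ℝ => f (g + t • (g * Matrix.single p.1 p.2 (1 : ℝ)))) 0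

/-- Noncommutative polynomials in the `E_ij`: finite complex combinations of words. They
represent the elements of the universal enveloping algebra of `𝔤𝔩₃(ℂ)`. -/
abbrev DiffOp : Type := List (Fin 3 × Fin 3) →₀ ℂ

/-- The action of a noncommutative polynomial as a differential operator. -/
def DiffOp.act (D : DiffOp) (f : Mat → ℂ) (g : Mat) : ℂ :=
  D.sum fun w c => c * (w.foldr deriv1 f) g

/-- The element of the universal enveloping algebra of `𝔤𝔩₃(ℂ)` that is represented. -/
def DiffOp.toEnveloping (D : DiffOp) :
    UniversalEnvelopingAlgebra ℂ (Matrix (Fin 3) (Fin 3) ℂ) :=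
  D.sum fun w c => c • (w.map fun p =>
    UniversalEnvelopingAlgebra.ι ℂ (Matrix.single p.1 p.2 (1 : ℂ))).prod

/-- `α` is a triple of Langlands parameters of `Φ`: `α₁ + α₂ + α₃ = 0`, and every `D` in the
center of the universal enveloping algebra has `Φ` and `I_α` as eigenfunctions with the same
eigenvalue. -/
def IsLanglandsParameter (Φ : Mat → ℂ) (α : Fin 3 → ℂ) : Prop :=
  α 0 + α 1 + α 2 = 0 ∧
  ∀ D : DiffOp, D.toEnveloping ∈ Subalgebra.center ℂ
      (UniversalEnvelopingAlgebra ℂ (Matrix (Fin 3) (Fin 3) ℂ)) →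
    ∃ lam : ℂ, ∀ g : Mat, g.det ≠ 0 →
      D.act Φ g = lam * Φ g ∧ D.act (powerFn α) g = lam * powerFn α g

/-! ### Maass cusp forms -/

/-- The point of `𝔥³` with coordinates `(u₁₂, u₁₃, u₂₃, y₀, y₁)`. -/
def point (x : ℝ × ℝ × ℝ × ℝ × ℝ) : Mat :=
  upper x.1 x.2.1 x.2.2.1 * torus x.2.2.2.1 x.2.2.2.2

/-- `Φ ∈ L²(SL₃(ℤ) \ 𝔥³)` for the invariant measure
`du₁₂ du₁₃ du₂₃ dy₀ dy₁ / (y₀y₁)³`: `|Φ|²` has a finite integral over some measurable set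
that meets every `SL₃(ℤ)`-orbit (such a set contains a fundamental domain, and a fundamental
domain is such a set). -/
def IsSquareIntegrable (Φ : Mat → ℂ) : Prop :=
  ∃ F : Set (ℝ × ℝ × ℝ × ℝ × ℝ), MeasurableSet F ∧
    (∀ x ∈ F, 0 < x.2.2.2.1 ∧ 0 < x.2.2.2.2) ∧
    (∀ g : Mat, g.det ≠ 0 → ∃ γ : Matrix.SpecialLinearGroup (Fin 3) ℤ, ∃ x ∈ F,
      ∃ k ∈ Matrix.orthogonalGroup (Fin 3) ℝ, ∃ r : ℝ, r ≠ 0 ∧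
        γ.1.map (fun n : ℤ => (n : ℝ)) * g = r • (point x * k)) ∧
    ∫⁻ x in F, ‖Φ (point x)‖ₑ ^ 2 *
      ENNReal.ofReal (1 / (x.2.2.2.1 * x.2.2.2.2) ^ 3) < ⊤

/-- The integrals of `Φ` along the unipotent radicals of all standard parabolic subgroups
(types `(2,1)`, `(1,2)` and `(1,1,1)`) vanish. -/
def IsCuspidal (Φ : Mat → ℂ) : Prop :=
  ∀ g : Mat, g.det ≠ 0 →
    (∫ u23 in (0 : ℝ)..1, ∫ u13 in (0 : ℝ)..1, Φ (upper 0 u13 u23 * g)) = 0 ∧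
    (∫ u13 in (0 : ℝ)..1, ∫ u12 in (0 : ℝ)..1, Φ (upper u12 u13 0 * g)) = 0 ∧
    (∫ u23 in (0 : ℝ)..1, ∫ u13 in (0 : ℝ)..1, ∫ u12 in (0 : ℝ)..1,
      Φ (upper u12 u13 u23 * g)) = 0

/-- `Φ` is a Maass cusp form of `SL₃(ℤ)` with Langlands parameters `α`. -/
structure IsMaassCuspForm (Φ : Mat → ℂ) (α : Fin 3 → ℂ) : Prop where
  automorphic : IsAutomorphicFunction Φ
  squareIntegrable : IsSquareIntegrable Φ
  langlands : IsLanglandsParameter Φ α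
  cuspidal : IsCuspidal Φ

/-- `b` satisfies the defining property of the `(m₁, m₂)`-th Fourier coefficient. (The sign of
`m₂` does not affect the Whittaker function on diagonal matrices.) -/
def IsFourierCoeff (Φ : Mat → ℂ) (α : Fin 3 → ℂ) (m1 m2 : ℤ) (b : ℂ) : Prop :=
  ∀ y0 y1 : ℝ, 0 < y0 → 0 < y1 →
    period Φ m1 m2 (torus y0 y1) =
      b / |(m1 * m2 : ℝ)| * whittaker α (|(m1 : ℝ)| * y0) (|(m2 : ℝ)| * y1)

open Classical in
/-- The `(m₁, m₂)`-th Fourier coefficient `B_Φ(m₁, m₂)`: the number `b` with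
`(Φ^)_(m₁,m₂)(diag(y₀y₁, y₀, 1)) = b / |m₁m₂| · W_α(|m₁|y₀, |m₂|y₁)` for all `y₀, y₁ > 0`
(and `0` if there is none). -/
def maassFourierCoeff (Φ : Mat → ℂ) (α : Fin 3 → ℂ) (m1 m2 : ℤ) : ℂ :=
  if h : ∃ b : ℂ, IsFourierCoeff Φ α m1 m2 b then h.choose else 0

/-- The Hecke operator `T_n`:
`(T_n Φ)(g) = 1/n · ∑ Φ([a, b₁, c₁; 0, b, c₂; 0, 0, c] g)` over
`a b c = n`, `0 ≤ b₁ < b`, `0 ≤ c₁, c₂ < c`. -/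
def hecke (n : ℕ) (Φ : Mat → ℂ) (g : Mat) : ℂ :=
  1 / (n : ℂ) * ∑ p ∈ n.divisorsAntidiagonal, ∑ q ∈ p.2.divisorsAntidiagonal,
    ∑ b1 ∈ Finset.range q.1, ∑ c1 ∈ Finset.range q.2, ∑ c2 ∈ Finset.range q.2,
      Φ (!![(p.1 : ℝ), (b1 : ℝ), (c1 : ℝ); 0, (q.1 : ℝ), (c2 : ℝ); 0, 0, (q.2 : ℝ)] * g)

/-- `Φ` is Hecke-normalized: an eigenfunction of all Hecke operators whose first Fourier
coefficient is `1`. -/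
def IsHeckeNormalized (Φ : Mat → ℂ) (α : Fin 3 → ℂ) : Prop :=
  (∀ n : ℕ, 1 ≤ n → ∃ lam : ℂ, ∀ g : Mat, g.det ≠ 0 → hecke n Φ g = lam * Φ g) ∧
  maassFourierCoeff Φ α 1 1 = 1

/-! ### The two kinds of terms of the explicit formula -/

/-- `B_Φ(a₁,1) / |a₁| · W_α(|a₁|y₀, y₁)`. -/
def diagonalTerm (Φ : Mat → ℂ) (α : Fin 3 → ℂ) (y0 y1 : ℝ) (a1 : ℤ) : ℂ :=
  maassFourierCoeff Φ α a1 1 / |(a1 : ℝ)| * whittaker α (|(a1 : ℝ)| * y0) y1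

/-- `B_Φ(a₁,1) / |a₁| · W_α(|a₁|y₀ / (1 + (a₀y₀)²), y₁ √(1 + (a₀y₀)²))
· e(-a₀a₁y₀² / (1 + (a₀y₀)²))`. -/
def offDiagonalTerm (Φ : Mat → ℂ) (α : Fin 3 → ℂ) (y0 y1 : ℝ) (a0 a1 : ℤ) : ℂ :=
  maassFourierCoeff Φ α a1 1 / |(a1 : ℝ)| *
    whittaker α (|(a1 : ℝ)| * y0 / (1 + (a0 * y0) ^ 2)) (y1 * Real.sqrt (1 + (a0 * y0) ^ 2)) *
    e (-(a0 * a1 * y0 ^ 2 / (1 + (a0 * y0) ^ 2)))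

end GL3

end

/-!
The expansion comes from two Fourier series in one variable. Let `h(u₁₃)` be the integral of
`Φ(n(u₁₂, u₁₃, 0) t) e(-u₁₂)` over `u₁₂ ∈ [0, 1]`. It is smooth, and it has period one by
invariance under integral unipotent matrices, so `h(0)`, the incomplete integral, is the
absolutely convergent sum over `a₀` of the Fourier coefficients of `h`. By invariance under the
integral matrix with `(3,2)` entry `a₀` (`integral_lower32`), the `a₀`-th coefficient is the
integral of `Φ(n(u₁₂, u₁₃, 0) g) e(-u₁₂)` over `u₁₂, u₁₃`, where `g` is the translate of `t` by
`lower32 (-a₀)`. That integral is the value at `u₂₃ = 0` of a smooth function of period one whose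
Fourier coefficients are the periods `(a₁, 1)` at `g` (`hasSum_period`).

For a cusp form the periods with `a₁ = 0` vanish, because they contain the integral over a
unipotent radical (`period_zero_left`). The remaining ones are computed from the Iwasawa
decomposition of `lower32 (-a₀) * t` (`lower32_mul_torus`), once it is known that the period
`(a₁, 1)` is a multiple of the Whittaker function. No multiplicity-one theorem is needed for this:
since `B(1, 1) = 1` is nonzero, the period `(1, 1)` is the Whittaker function, and in the period
`(1, 1)` of `T_n Φ` only the cosets with diagonal `(1, 1, n)` survive, which leaves the period
`(n, 1)` of `Φ` (`period_hecke`). So the Hecke eigenvalue equation gives the period `(n, 1)`, and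
the sign of `a₁` is immaterial on diagonal matrices (`period_neg_torus`).
-/

open scoped ContDiff

noncomputable section

namespace GL3

/-! ### The additive character and periodic functions -/

theorem e_add (x y : ℝ) : e (x + y) = e x * e y := by
  simp only [e, ← Complex.exp_add]
  congr 1
  push_cast
  ring

theorem e_zero : e 0 = 1 := by simp [e]

theorem e_int (n : ℤ) : e n = 1 := by
  rw [e, Complex.exp_eq_one_iff]
  exact ⟨n, by push_cast; ring⟩

theorem e_eq_one_iff (x : ℝ) : e x = 1 ↔ ∃ n : ℤ, x = n := by
  refine ⟨fun h => ?_, fun ⟨n, hn⟩ => hn ▸ e_int n⟩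
  obtain ⟨n, hn⟩ := Complex.exp_eq_one_iff.1 h
  refine ⟨n, ?_⟩
  have : (2 * Real.pi * Complex.I : ℂ) ≠ 0 := by
    simp [Real.pi_ne_zero]
  have h2 : (x : ℂ) = n := by
    apply mul_left_cancel₀ this
    rw [hn]; ring
  exact_mod_cast h2

theorem contDiff_e : ContDiff ℝ ∞ e := by
  have h : ContDiff ℝ ∞ fun x : ℝ => (x : ℂ) := Complex.ofRealCLM.contDiff
  exact (contDiff_const.mul h).cexp

@[fun_prop]
theorem continuous_e : Continuous e := contDiff_e.continuous

theorem e_periodic_int (n : ℤ) (x : ℝ) : e (-(n * (x + 1))) = e (-(n * x)) := by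
  have : -(n * (x + 1)) = -(n * x) + ((-n : ℤ) : ℝ) := by push_cast; ring
  rw [this, e_add, e_int, mul_one]

/-- The integral over a period does not change under translation. -/
theorem integral_comp_add_of_periodic {f : ℝ → ℂ} (hf : Function.Periodic f 1) (s : ℝ) :
    ∫ x in (0 : ℝ)..1, f (x + s) = ∫ x in (0 : ℝ)..1, f x := by
  rw [intervalIntegral.integral_comp_add_right (fun x => f x) s]
  have := hf.intervalIntegral_add_eq s 0
  simpa [add_comm] using this

/-- Translating a periodic function multiplies its `k`-th Fourier coefficient by a character. -/
theorem integral_comp_add_mul_e {f : ℝ → ℂ} (hf : Function.Periodic f 1) (k : ℤ) (s : ℝ) :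
    ∫ x in (0 : ℝ)..1, f (x + s) * e (-(k * x)) =
      e (k * s) * ∫ x in (0 : ℝ)..1, f x * e (-(k * x)) := by
  have hp : Function.Periodic (fun x => f x * e (-(k * x))) 1 := fun x => by
    simp only [hf x, e_periodic_int]
  rw [← integral_comp_add_of_periodic hp s, ← intervalIntegral.integral_const_mul]
  congr 1
  ext x
  rw [show -(k * x) = k * s + -(k * (x + s)) by ring, e_add]
  ring

/-! ### Fourier series of smooth periodic functions -/

/-- Differentiation under the integral sign: an integral over a compact interval inherits the
smoothness of the integrand in the parameter. -/
theorem contDiff_intervalIntegral {E : Type} [NormedAddCommGroup E] [NormedSpace ℝ E]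
    [FiniteDimensional ℝ E] (n : ℕ) :
    ∀ {F : Type} [NormedAddCommGroup F] [NormedSpace ℝ F] {K : E × ℝ → F}
      (_ : ContDiff ℝ n K) (a b : ℝ), ContDiff ℝ n (fun x => ∫ u in a..b, K (x, u)) := by
  induction n with
  | zero =>
    intro F _ _ K hK a b
    rw [Nat.cast_zero, contDiff_zero] at hK ⊢
    exact intervalIntegral.continuous_parametric_intervalIntegral_of_continuous'
      (f := fun x u => K (x, u)) hK a b
  | succ n ih =>
    intro F _ _ K hK a b
    have hK' : ContDiff ℝ n (fun p : E × ℝ =>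
        (fderiv ℝ K p).comp (ContinuousLinearMap.inl ℝ E ℝ)) := by
      have : ContDiff ℝ n (fderiv ℝ K) := hK.fderiv_right (by norm_cast)
      exact this.clm_comp contDiff_const
    have hcont := hK'.continuous
    push_cast
    rw [contDiff_succ_iff_hasFDerivAt]
    refine ⟨fun x => ∫ u in a..b, (fderiv ℝ K (x, u)).comp (ContinuousLinearMap.inl ℝ E ℝ),
      ?_, fun x => ?_⟩
    · simpa using ih hK' a b
    · have : ProperSpace E := FiniteDimensional.proper ℝ E
      have hcomp : IsCompact (Metric.closedBall x 1 ×ˢ Set.uIcc a b) :=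
        (isCompact_closedBall x 1).prod isCompact_uIcc
      obtain ⟨C, hC⟩ := hcomp.exists_bound_of_continuousOn hcont.continuousOn
      refine (intervalIntegral.hasFDerivAt_integral_of_dominated_of_fderiv_le (𝕜 := ℝ)
        (F := fun x u => K (x, u))
        (F' := fun x u => (fderiv ℝ K (x, u)).comp (ContinuousLinearMap.inl ℝ E ℝ))
        (bound := fun _ => C) (s := Metric.closedBall x 1)
        (Metric.closedBall_mem_nhds x one_pos) ?_ ?_ ?_ ?_ ?_ ?_)
      · exact Filter.Eventually.of_forall fun y =>
          (hK.continuous.comp (by fun_prop : Continuous fun u : ℝ => (y, u))).aestronglyMeasurable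
      · exact (hK.continuous.comp
          (by fun_prop : Continuous fun u : ℝ => (x, u))).intervalIntegrable _ _
      · exact (hcont.comp (by fun_prop : Continuous fun u : ℝ => (x, u))).aestronglyMeasurable
      · exact Filter.Eventually.of_forall fun u hu y hy =>
          hC (y, u) ⟨hy, Set.uIoc_subset_uIcc hu⟩
      · exact intervalIntegrable_const
      · refine Filter.Eventually.of_forall fun u _ y _ => ?_
        have h1 := (hK.differentiable (by simp) (y, u)).hasFDerivAt
        exact h1.comp y (hasFDerivAt_prodMk_left y u)

/-- The Fourier series of a `C²` function of period one converges absolutely to the function. -/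
theorem hasSum_fourier_of_contDiff_two {h : ℝ → ℂ} (hh : ContDiff ℝ 2 h)
    (hp : Function.Periodic h 1) :
    HasSum (fun n : ℤ => ∫ x in (0 : ℝ)..1, h x * e (-(n * x))) (h 0) := by
  have : Fact ((0 : ℝ) < 1) := ⟨one_pos⟩
  have h1 : ContDiff ℝ 1 (deriv h) := by
    have : ContDiff ℝ (1 + 1) h := by norm_num; exact hh
    exact ((contDiff_succ_iff_deriv).1 this).2.2
  have h2 : Continuous (deriv (deriv h)) := h1.continuous_deriv le_rfl
  have hp' : Function.Periodic (deriv h) 1 := fun x => by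
    rw [← deriv_comp_add_const]
    congr 1
    ext y
    exact hp y
  have hco (f : ℝ → ℂ) (n : ℤ) : fourierCoeffOn (zero_lt_one' ℝ) f n =
      ∫ x in (0 : ℝ)..1, f x * e (-(n * x)) := by
    rw [fourierCoeffOn_eq_integral]
    simp only [sub_zero, div_one, one_smul, fourier_coe_apply, e, smul_eq_mul]
    congr 1
    ext x
    rw [mul_comm]
    congr 2
    push_cast
    ring
  obtain ⟨C, hC⟩ := (isCompact_Icc (a := (0 : ℝ)) (b := 1)).exists_bound_of_continuousOn
    h2.continuousOn
  let f : C(AddCircle (1 : ℝ), ℂ) := ⟨hp.lift, by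
    exact continuous_coinduced_dom.mpr hh.continuous⟩
  have hf (n : ℤ) : fourierCoeff f n = ∫ x in (0 : ℝ)..1, h x * e (-(n * x)) := by
    rw [fourierCoeff_eq_intervalIntegral f n 0, ← hco, fourierCoeffOn_eq_integral]
    simp [f]
  have hbound (n : ℤ) (hn : n ≠ 0) :
      ‖∫ x in (0 : ℝ)..1, h x * e (-(n * x))‖ ≤ C / (2 * Real.pi) ^ 2 * (1 / (n : ℝ) ^ 2) := by
    have e1 := fourierCoeffOn_of_hasDerivAt (zero_lt_one' ℝ) (f := h) (f' := deriv h) hn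
      (fun x _ => (hh.differentiable (by norm_num) x).hasDerivAt)
      (h1.continuous.intervalIntegrable _ _)
    have e2 := fourierCoeffOn_of_hasDerivAt (zero_lt_one' ℝ) (f := deriv h)
      (f' := deriv (deriv h)) hn
      (fun x _ => (h1.differentiable (by norm_num) x).hasDerivAt)
      (h2.intervalIntegrable _ _)
    have v1 : h 1 = h 0 := by simpa using hp 0
    have v2 : deriv h 1 = deriv h 0 := by simpa using hp' 0
    rw [hco, hco] at e1 e2
    rw [v1, e2] at e1
    rw [v2] at e1
    have hb : ‖∫ x in (0 : ℝ)..1, deriv (deriv h) x * e (-(n * x))‖ ≤ C := by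
      have := intervalIntegral.norm_integral_le_of_norm_le_const (a := (0 : ℝ)) (b := 1)
        (C := C) (f := fun x => deriv (deriv h) x * e (-(n * x))) (fun x hx => by
          rw [norm_mul]
          have : ‖e (-(n * x))‖ = 1 := by
            rw [e, show (2 * Real.pi * Complex.I * ((-(n * x) : ℝ) : ℂ)) =
              ((2 * Real.pi * (-(n * x)) : ℝ) : ℂ) * Complex.I by push_cast; ring]
            exact Complex.norm_exp_ofReal_mul_I _
          rw [this, mul_one]
          rw [Set.uIoc_of_le zero_le_one] at hx
          exact hC x ⟨hx.1.le, hx.2⟩)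
      simpa using this
    rw [e1]
    simp only [sub_self, mul_zero, zero_sub, norm_mul, norm_div, norm_neg, norm_one,
      Complex.ofReal_one, sub_zero, Complex.norm_I, Complex.norm_real, one_mul, mul_one,
      Complex.norm_intCast, Complex.norm_ofNat, Real.norm_eq_abs, abs_of_pos Real.pi_pos,
      Complex.ofReal_zero]
    have hn2 : (n : ℝ) ^ 2 = |(n : ℝ)| * |(n : ℝ)| := by rw [← sq, sq_abs]
    have : 0 < |(n : ℝ)| := by simpa using hn
    rw [hn2]
    calc _ = ‖∫ x in (0 : ℝ)..1, deriv (deriv h) x * e (-(n * x))‖ *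
          (1 / (2 * Real.pi) ^ 2 * (1 / (|(n : ℝ)| * |(n : ℝ)|))) := by
          field_simp
      _ ≤ C * (1 / (2 * Real.pi) ^ 2 * (1 / (|(n : ℝ)| * |(n : ℝ)|))) := by gcongr
      _ = _ := by ring
  have hsum : Summable (fourierCoeff f) := by
    have hs : Summable fun n : ℤ => C / (2 * Real.pi) ^ 2 * (1 / (n : ℝ) ^ 2) :=
      (Real.summable_one_div_int_pow.2 one_lt_two).mul_left _
    refine Summable.of_norm_bounded_eventually hs ?_
    filter_upwards [(Set.finite_singleton (0 : ℤ)).compl_mem_cofinite] with n hn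
    rw [hf]
    exact hbound n (by simpa using hn)
  have := has_pointwise_sum_fourier_series_of_summable hsum 0
  simp only [hf, fourier_eval_zero, smul_eq_mul, mul_one] at this
  have hf0 : f 0 = h 0 := by
    rw [← QuotientAddGroup.mk_zero]
    exact hp.lift_coe 0
  rwa [hf0] at this

/-! ### Sums over residue classes -/

/-- The sum `∑_{j < q} h((x + j) / q)` over residues of a function of period one has period one. -/
theorem periodic_sum_div {h : ℝ → ℂ} (hp : Function.Periodic h 1) {q : ℕ} (hq : q ≠ 0) :
    Function.Periodic (fun x : ℝ => ∑ j ∈ Finset.range q, h ((x + j) / q)) 1 := by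
  intro x
  have hq' : (q : ℝ) ≠ 0 := by exact_mod_cast hq
  have hend : h ((x + (q : ℕ)) / q) = h ((x + (0 : ℕ)) / q) := by
    rw [← hp ((x + (0 : ℕ)) / q)]
    congr 1
    field_simp
    simp
  have h1 := Finset.sum_range_succ (fun j : ℕ => h ((x + j) / q)) q
  have h2 := Finset.sum_range_succ' (fun j : ℕ => h ((x + j) / q)) q
  rw [hend, h2] at h1
  simp only
  rw [← add_right_cancel h1]
  refine Finset.sum_congr rfl fun j _ => ?_
  congr 2
  push_cast
  ring

/-- Over the period `q`, an integral splits into the shifted integrals over `[0, 1]`. -/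
theorem sum_integral_shift {F : ℝ → ℂ} (hF : Continuous F) (q : ℕ) :
    ∑ j ∈ Finset.range q, ∫ x in (0 : ℝ)..1, F (x + j) = ∫ x in (0 : ℝ)..q, F x := by
  have := intervalIntegral.sum_integral_adjacent_intervals (f := F) (μ := MeasureTheory.volume)
    (a := fun j : ℕ => (j : ℝ)) (n := q) (fun k _ => hF.intervalIntegrable _ _)
  simp only [Nat.cast_zero] at this
  rw [← this]
  refine Finset.sum_congr rfl fun j _ => ?_
  rw [intervalIntegral.integral_comp_add_right (fun x => F x) (j : ℝ)]
  congr 1 <;> push_cast <;> ring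

/-- For `H` of period one and `p ≥ 2`, the first Fourier coefficient of `x ↦ H(p x + s)`
vanishes, since this function has period `1 / p`. -/
theorem integral_comp_mul_mul_e_eq_zero {H : ℝ → ℂ} (hH : Function.Periodic H 1) {p : ℕ}
    (hp : 2 ≤ p) (s : ℝ) : ∫ x in (0 : ℝ)..1, H (p * x + s) * e (-x) = 0 := by
  have hp0 : (p : ℝ) ≠ 0 := by positivity
  have hper : Function.Periodic (fun x : ℝ => H (p * x + s)) 1 := fun x => by
    have := hH.nat_mul p (p * x + s)
    simp only
    rw [← this]
    congr 1
    ring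
  -- The substitution `x ↦ x + 1 / p` multiplies the integral by `e(1 / p) ≠ 1`.
  have key := integral_comp_add_mul_e hper 1 (1 / p)
  have : (fun x : ℝ => H (p * (x + 1 / p) + s)) = fun x => H (p * x + s) := by
    ext x
    rw [← hH (p * x + s)]
    congr 1
    field_simp
    ring
  have hpt (x : ℝ) : H (p * (x + 1 / p) + s) = H (p * x + s) := congrFun this x
  simp only [hpt, Int.cast_one, one_mul] at key
  by_contra hne
  have h1 : e (1 / p) = 1 := (mul_eq_right₀ hne).1 key.symm
  obtain ⟨n, hn⟩ := (e_eq_one_iff _).1 h1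
  have h2 : (1 : ℝ) = (n * p : ℤ) := by
    push_cast
    rw [← hn]
    field_simp
  have h3 : (1 : ℤ) = n * p := by exact_mod_cast h2
  have h4 : (p : ℤ) ∣ 1 := ⟨n, by rw [h3]; ring⟩
  have := Int.le_of_dvd one_pos h4
  omega

/-- Summing over residues modulo `q` and stretching by `p` multiplies the zeroth Fourier
coefficient by `q`. -/
theorem sum_integral_comp_div {h : ℝ → ℂ} (hc : Continuous h) (hp : Function.Periodic h 1)
    {p q : ℕ} (hp0 : p ≠ 0) (hq : q ≠ 0) (s : ℝ) :
    ∑ j ∈ Finset.range q, ∫ x in (0 : ℝ)..1, h ((p * x + s + j) / q) =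
      q * ∫ x in (0 : ℝ)..1, h x := by
  have hp' : (p : ℝ) ≠ 0 := by exact_mod_cast hp0
  have hq' : (q : ℝ) ≠ 0 := by exact_mod_cast hq
  have hH := periodic_sum_div hp hq
  set H : ℝ → ℂ := fun x : ℝ => ∑ j ∈ Finset.range q, h ((x + j) / q) with hHdef
  have hHs : Function.Periodic (fun x => H (x + s)) 1 := fun x => by
    simp only
    rw [← hH (x + s)]
    congr 1
    ring
  rw [← intervalIntegral.integral_finsetSum
    (fun (j : ℕ) _ => (by fun_prop : Continuous fun x : ℝ =>
      h ((p * x + s + j) / q)).intervalIntegrable _ _)]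
  calc ∫ x in (0 : ℝ)..1, H (p * x + s)
      = (p : ℝ)⁻¹ • ∫ x in (0 : ℝ)..p, H (x + s) := by
        rw [intervalIntegral.integral_comp_mul_left (fun x => H (x + s)) hp']
        simp
    _ = ∫ x in (0 : ℝ)..1, H (x + s) := by
        have := hHs.intervalIntegral_add_zsmul_eq p 0
        simp only [zero_add] at this
        rw [show ((p : ℤ) • (1 : ℝ)) = p by simp] at this
        have hcont : Continuous fun x => H (x + s) := by fun_prop
        rw [this (fun a b => hcont.intervalIntegrable a b), zsmul_eq_mul, Complex.real_smul]
        push_cast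
        exact inv_mul_cancel_left₀ (by exact_mod_cast hp0) _
    _ = ∫ x in (0 : ℝ)..1, H x := integral_comp_add_of_periodic hH s
    _ = ∑ j ∈ Finset.range q, ∫ x in (0 : ℝ)..1, h ((x + j) / q) :=
        intervalIntegral.integral_finsetSum (fun (j : ℕ) _ => (by fun_prop : Continuous fun x : ℝ =>
          h ((x + j) / q)).intervalIntegrable _ _)
    _ = ∫ x in (0 : ℝ)..q, h (x / q) :=
        sum_integral_shift (F := fun x => h (x / q)) (by fun_prop) q
    _ = q * ∫ x in (0 : ℝ)..1, h x := by
        rw [intervalIntegral.integral_comp_div (fun x => h x) hq']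
        simp [hq']

/-- The sum `∑_{j < q} h((x + j) / q)` over residues has as first Fourier coefficient `q` times
the `q`-th coefficient of `h`; stretching by `p ≥ 2` kills the first coefficient. -/
theorem sum_integral_comp_div_mul_e {h : ℝ → ℂ} (hc : Continuous h)
    (hp : Function.Periodic h 1) {p q : ℕ} (hp0 : p ≠ 0) (hq : q ≠ 0) :
    ∑ j ∈ Finset.range q, ∫ x in (0 : ℝ)..1, h ((p * x + j) / q) * e (-x) =
      if p = 1 then q * ∫ x in (0 : ℝ)..1, h x * e (-(q * x)) else 0 := by
  have hq' : (q : ℝ) ≠ 0 := by exact_mod_cast hq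
  split_ifs with h1
  · subst h1
    have hF : Continuous fun x : ℝ => h (x / q) * e (-(q * (x / q))) := by fun_prop
    calc _ = ∑ j ∈ Finset.range q, ∫ x in (0 : ℝ)..1,
          (fun x : ℝ => h (x / q) * e (-(q * (x / q)))) (x + j) := by
          refine Finset.sum_congr rfl fun j _ => ?_
          congr 1
          ext x
          simp only [Nat.cast_one, one_mul]
          congr 1
          rw [mul_div_cancel₀ _ hq', show -(x + (j : ℝ)) = -x + ((-j : ℤ) : ℝ) by
            push_cast; ring, e_add, e_int, mul_one]
      _ = ∫ x in (0 : ℝ)..q, h (x / q) * e (-(q * (x / q))) := sum_integral_shift hF q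
      _ = _ := by
          rw [intervalIntegral.integral_comp_div (fun x => h x * e (-(q * x))) hq']
          simp [hq']
  · rw [← intervalIntegral.integral_finsetSum
      (fun (j : ℕ) _ => (by fun_prop : Continuous fun x : ℝ =>
        h ((p * x + j) / q) * e (-x)).intervalIntegrable _ _)]
    simp only [← Finset.sum_mul]
    simpa using integral_comp_mul_mul_e_eq_zero (periodic_sum_div hp hq) (p := p)
      (by omega) 0

/-! ### Matrix identities -/

theorem det_upper (a b c : ℝ) : (upper a b c).det = 1 := by
  simp [upper, Matrix.det_fin_three]

theorem det_lower32 (x : ℝ) : (lower32 x).det = 1 := by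
  simp [lower32, Matrix.det_fin_three]

theorem det_torus (y0 y1 : ℝ) : (torus y0 y1).det = y0 * y1 * y0 := by
  simp [torus, Matrix.det_fin_three]

theorem det_torus_ne_zero {y0 y1 : ℝ} (h0 : 0 < y0) (h1 : 0 < y1) : (torus y0 y1).det ≠ 0 := by
  rw [det_torus]
  positivity

theorem det_upper_mul_ne_zero (a b c : ℝ) {g : Mat} (hg : g.det ≠ 0) :
    (upper a b c * g).det ≠ 0 := by
  rwa [Matrix.det_mul, det_upper, one_mul]

theorem det_lower32_mul_ne_zero (x : ℝ) {g : Mat} (hg : g.det ≠ 0) :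
    (lower32 x * g).det ≠ 0 := by
  rwa [Matrix.det_mul, det_lower32, one_mul]

theorem upper_mul_upper (a b c a' b' c' : ℝ) :
    upper a b c * upper a' b' c' = upper (a + a') (b + b' + a * c') (c + c') := by
  ext i j
  fin_cases i <;> fin_cases j <;> simp [upper, Matrix.mul_apply, Fin.sum_univ_three] <;> ring

theorem upper_mul_lower32 (a b x : ℝ) :
    upper a b 0 * lower32 x = lower32 x * upper (a + b * x) b 0 := by
  ext i j
  fin_cases i <;> fin_cases j <;>
    simp [upper, lower32, Matrix.mul_apply, Fin.sum_univ_three]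

/-! ### Automorphic functions along the unipotent group -/

namespace IsAutomorphicFunction

variable {Φ : Mat → ℂ} {g : Mat}

theorem apply_upper_int_mul (hΦ : IsAutomorphicFunction Φ) (a b c : ℤ) (hg : g.det ≠ 0) :
    Φ (upper a b c * g) = Φ g := by
  have h := hΦ.left_inv ⟨!![1, a, b; 0, 1, c; 0, 0, 1], by simp [Matrix.det_fin_three]⟩ g hg
  rw [← h]
  congr 2
  ext i j
  fin_cases i <;> fin_cases j <;> simp [upper]

theorem apply_lower32_int_mul (hΦ : IsAutomorphicFunction Φ) (a : ℤ) (hg : g.det ≠ 0) :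
    Φ (lower32 a * g) = Φ g := by
  have h := hΦ.left_inv ⟨!![1, 0, 0; 0, 1, 0; 0, a, 1], by simp [Matrix.det_fin_three]⟩ g hg
  rw [← h]
  congr 2
  ext i j
  fin_cases i <;> fin_cases j <;> simp [lower32]

theorem contDiff_upper (hΦ : IsAutomorphicFunction Φ) (hg : g.det ≠ 0) :
    ContDiff ℝ ∞ fun p : ℝ × ℝ × ℝ => Φ (upper p.1 p.2.1 p.2.2 * g) := by
  have h1 : ContDiff ℝ ∞ fun (p : ℝ × ℝ × ℝ) (i j : Fin 3) =>
      (upper p.1 p.2.1 p.2.2 * g) i j := by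
    refine contDiff_pi.2 fun i => contDiff_pi.2 fun j => ?_
    fin_cases i <;> simp [upper, Matrix.mul_apply, Fin.sum_univ_three] <;> fun_prop
  exact hΦ.smooth.comp_contDiff h1 fun p => det_upper_mul_ne_zero p.1 p.2.1 p.2.2 hg

theorem continuous_upper (hΦ : IsAutomorphicFunction Φ) (hg : g.det ≠ 0) {X : Type*}
    [TopologicalSpace X] {a b c : X → ℝ} (ha : Continuous a) (hb : Continuous b)
    (hc : Continuous c) : Continuous fun x => Φ (upper (a x) (b x) (c x) * g) :=
  (hΦ.contDiff_upper hg).continuous.comp (ha.prodMk (hb.prodMk hc))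

theorem upper12_add_one (hΦ : IsAutomorphicFunction Φ) (hg : g.det ≠ 0) (a b c : ℝ) :
    Φ (upper (a + 1) (b + c) c * g) = Φ (upper a b c * g) := by
  rw [← hΦ.apply_upper_int_mul 1 0 0 (det_upper_mul_ne_zero a b c hg), ← mul_assoc,
    upper_mul_upper]
  congr 3 <;> push_cast <;> ring

theorem upper13_add_one (hΦ : IsAutomorphicFunction Φ) (hg : g.det ≠ 0) (a b c : ℝ) :
    Φ (upper a (b + 1) c * g) = Φ (upper a b c * g) := by
  rw [← hΦ.apply_upper_int_mul 0 1 0 (det_upper_mul_ne_zero a b c hg), ← mul_assoc,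
    upper_mul_upper]
  congr 3 <;> push_cast <;> ring

theorem upper23_add_one (hΦ : IsAutomorphicFunction Φ) (hg : g.det ≠ 0) (a b c : ℝ) :
    Φ (upper a b (c + 1) * g) = Φ (upper a b c * g) := by
  rw [← hΦ.apply_upper_int_mul 0 0 1 (det_upper_mul_ne_zero a b c hg), ← mul_assoc,
    upper_mul_upper]
  congr 3 <;> push_cast <;> ring

end IsAutomorphicFunction

/-! ### The Fourier expansion of the incomplete integral -/

/-- Fourier expansion in `u₂₃`: the periods with `m₂ = 1` sum to the integral of `Φ · e(-u₁₂)`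
over the slice `u₂₃ = 0`. -/
theorem hasSum_period {Φ : Mat → ℂ} (hΦ : IsAutomorphicFunction Φ) {g : Mat} (hg : g.det ≠ 0) :
    HasSum (fun m : ℤ => period Φ m 1 g)
      (∫ u13 in (0 : ℝ)..1, ∫ u12 in (0 : ℝ)..1, Φ (upper u12 u13 0 * g) * e (-u12)) := by
  set h : ℝ → ℂ := fun u23 => ∫ u13 in (0 : ℝ)..1, ∫ u12 in (0 : ℝ)..1,
    Φ (upper u12 u13 u23 * g) * e (-u12) with hdef
  have hK : ContDiff ℝ (2 : ℕ) fun p : (ℝ × ℝ) × ℝ =>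
      Φ (upper p.2 p.1.2 p.1.1 * g) * e (-p.2) := by
    have h1 := ((hΦ.contDiff_upper hg).comp (by fun_prop :
      ContDiff ℝ ∞ fun p : (ℝ × ℝ) × ℝ => (p.2, p.1.2, p.1.1))).mul
      (contDiff_e.comp (by fun_prop : ContDiff ℝ ∞ fun p : (ℝ × ℝ) × ℝ => -p.2))
    exact contDiff_infty.1 h1 2
  have hc : ContDiff ℝ 2 h := by
    have := contDiff_intervalIntegral 2 (contDiff_intervalIntegral 2 hK 0 1) 0 1
    exact_mod_cast this
  have hp : Function.Periodic h 1 := fun x => by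
    simp only [hdef, hΦ.upper23_add_one hg]
  have := hasSum_fourier_of_contDiff_two hc hp
  convert this using 2 with m
  rw [period]
  congr 1
  ext u23
  simp only [hdef, ← intervalIntegral.integral_mul_const]
  congr 1
  ext u13
  congr 1
  ext u12
  rw [mul_assoc, ← e_add]
  congr 2
  push_cast
  ring

/-- Left invariance under the integral matrix with `(3,2)` entry `-a` turns the partial integral
at a translate of `g` into the `a`-th Fourier coefficient in `u₁₃` of the partial integral
at `g`. -/
theorem integral_lower32 {Φ : Mat → ℂ} (hΦ : IsAutomorphicFunction Φ) {g : Mat}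
    (hg : g.det ≠ 0) (a : ℤ) :
    (∫ u13 in (0 : ℝ)..1, ∫ u12 in (0 : ℝ)..1,
      Φ (upper u12 u13 0 * (lower32 (-(a : ℝ)) * g)) * e (-u12)) =
    ∫ u13 in (0 : ℝ)..1, (∫ u12 in (0 : ℝ)..1, Φ (upper u12 u13 0 * g) * e (-u12)) *
      e (-(a * u13)) := by
  congr 1
  ext u13
  have hp : Function.Periodic (fun x => Φ (upper x u13 0 * g)) 1 := fun x => by
    simpa using hΦ.upper12_add_one hg x u13 0
  have key := integral_comp_add_mul_e hp 1 (u13 * (-(a : ℝ)))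
  simp only [Int.cast_one, one_mul] at key
  rw [mul_comm (∫ u12 in (0 : ℝ)..1, _), show -(a * u13) = u13 * (-(a : ℝ)) by ring, ← key]
  congr 1
  ext u12
  rw [← mul_assoc, upper_mul_lower32, mul_assoc,
    show (-(a : ℝ)) = ((-a : ℤ) : ℝ) by push_cast; rfl,
    hΦ.apply_lower32_int_mul _ (det_upper_mul_ne_zero _ _ _ hg)]

/-- Fourier expansion in `u₁₃`, combined with the expansion in `u₂₃`. -/
theorem hasSum_tsum_period {Φ : Mat → ℂ} (hΦ : IsAutomorphicFunction Φ) {y0 y1 : ℝ}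
    (h0 : 0 < y0) (h1 : 0 < y1) :
    HasSum (fun a0 : ℤ => ∑' a1 : ℤ, period Φ a1 1 (lower32 (-(a0 : ℝ)) * torus y0 y1))
      (incompleteIntegral Φ y0 y1) := by
  have hg := det_torus_ne_zero h0 h1
  set g := torus y0 y1
  set h : ℝ → ℂ := fun u13 => ∫ u12 in (0 : ℝ)..1, Φ (upper u12 u13 0 * g) * e (-u12) with hdef
  have hK : ContDiff ℝ (2 : ℕ) fun p : ℝ × ℝ => Φ (upper p.2 p.1 0 * g) * e (-p.2) := by
    have h1 := ((hΦ.contDiff_upper hg).comp (by fun_prop :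
      ContDiff ℝ ∞ fun p : ℝ × ℝ => (p.2, p.1, (0 : ℝ)))).mul
      (contDiff_e.comp (by fun_prop : ContDiff ℝ ∞ fun p : ℝ × ℝ => -p.2))
    exact contDiff_infty.1 h1 2
  have hc : ContDiff ℝ 2 h := by
    have := contDiff_intervalIntegral 2 hK 0 1
    exact_mod_cast this
  have hp : Function.Periodic h 1 := fun x => by
    simp only [hdef, hΦ.upper13_add_one hg]
  have := hasSum_fourier_of_contDiff_two hc hp
  have hinc : incompleteIntegral Φ y0 y1 = h 0 := rfl
  rw [hinc]
  convert this using 2 with a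
  rw [(hasSum_period hΦ (det_lower32_mul_ne_zero _ hg)).tsum_eq, integral_lower32 hΦ hg]

/-! ### Integration along the centre of the unipotent group -/

theorem integral_swap {F : ℝ → ℝ → ℂ} (hF : Continuous (Function.uncurry F)) :
    ∫ x in (0 : ℝ)..1, ∫ y in (0 : ℝ)..1, F x y = ∫ y in (0 : ℝ)..1, ∫ x in (0 : ℝ)..1, F x y := by
  refine MeasureTheory.intervalIntegral_intervalIntegral_swap ?_
  exact (hF.continuousOn.integrableOn_compact (isCompact_uIcc.prod isCompact_uIcc)).mono_set
    (Set.prod_mono Set.uIoc_subset_uIcc Set.uIoc_subset_uIcc)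

theorem integral_sum_mul {ι : Type*} (s : Finset ι) {f : ι → ℝ → ℂ} {k : ℝ → ℂ}
    (hf : ∀ i ∈ s, Continuous (f i)) (hk : Continuous k) :
    ∫ x in (0 : ℝ)..1, (∑ i ∈ s, f i x) * k x = ∑ i ∈ s, ∫ x in (0 : ℝ)..1, f i x * k x := by
  rw [← intervalIntegral.integral_finsetSum
    (f := fun i x => f i x * k x) (fun i hi => ((hf i hi).mul hk).intervalIntegrable _ _)]
  simp only [Finset.sum_mul]

/-- The integral of `Φ` over `u₁₃`, i.e. along the centre of the unipotent group. -/
def centralIntegral (Φ : Mat → ℂ) (g : Mat) (u12 u23 : ℝ) : ℂ :=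
  ∫ u13 in (0 : ℝ)..1, Φ (upper u12 u13 u23 * g)

/-- Continuity of `Φ` on the orbit of `g` under the unipotent group. -/
def IsContinuousAlong (Φ : Mat → ℂ) (g : Mat) : Prop :=
  Continuous fun p : ℝ × ℝ × ℝ => Φ (upper p.1 p.2.1 p.2.2 * g)

theorem IsAutomorphicFunction.isContinuousAlong {Φ : Mat → ℂ} (hΦ : IsAutomorphicFunction Φ)
    {g : Mat} (hg : g.det ≠ 0) : IsContinuousAlong Φ g :=
  (hΦ.contDiff_upper hg).continuous

theorem IsContinuousAlong.comp {Φ : Mat → ℂ} {g : Mat} (h : IsContinuousAlong Φ g) {X : Type*}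
    [TopologicalSpace X] {a b c : X → ℝ} (ha : Continuous a) (hb : Continuous b)
    (hc : Continuous c) : Continuous fun x => Φ (upper (a x) (b x) (c x) * g) :=
  Continuous.comp (g := fun p : ℝ × ℝ × ℝ => Φ (upper p.1 p.2.1 p.2.2 * g)) h
    (ha.prodMk (hb.prodMk hc))

theorem IsContinuousAlong.finsetSum {ι : Type*} {s : Finset ι} {Φ : ι → Mat → ℂ} {g : Mat}
    (h : ∀ i ∈ s, IsContinuousAlong (Φ i) g) :
    IsContinuousAlong (fun x => ∑ i ∈ s, Φ i x) g :=
  continuous_finsetSum s h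

theorem continuous_centralIntegral {Φ : Mat → ℂ} {g : Mat} (h : IsContinuousAlong Φ g)
    {X : Type*} [TopologicalSpace X] {a c : X → ℝ} (ha : Continuous a) (hc : Continuous c) :
    Continuous fun x => centralIntegral Φ g (a x) (c x) := by
  have hq : Continuous fun q : (ℝ × ℝ) × ℝ => Φ (upper q.1.1 q.2 q.1.2 * g) :=
    h.comp (by fun_prop) (by fun_prop) (by fun_prop)
  have h1 : Continuous fun p : ℝ × ℝ => centralIntegral Φ g p.1 p.2 :=
    intervalIntegral.continuous_parametric_intervalIntegral_of_continuous'
      (f := fun (p : ℝ × ℝ) u => Φ (upper p.1 u p.2 * g)) hq 0 1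
  have hac : Continuous fun x => (a x, c x) := ha.prodMk hc
  have h2 := h1.comp hac
  simpa only [Function.comp_def] using h2

theorem centralIntegral_finsetSum {ι : Type*} {s : Finset ι} {Φ : ι → Mat → ℂ} {g : Mat}
    (h : ∀ i ∈ s, IsContinuousAlong (Φ i) g) (u12 u23 : ℝ) :
    centralIntegral (fun x => ∑ i ∈ s, Φ i x) g u12 u23 =
      ∑ i ∈ s, centralIntegral (Φ i) g u12 u23 :=
  intervalIntegral.integral_finsetSum fun i hi =>
    ((h i hi).comp continuous_const continuous_id continuous_const).intervalIntegrable _ _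

/-- A period as an integral of the central integral. -/
theorem period_eq_integral_centralIntegral {Φ : Mat → ℂ} {g : Mat} (h : IsContinuousAlong Φ g)
    (m1 m2 : ℤ) :
    period Φ m1 m2 g = ∫ u23 in (0 : ℝ)..1, (∫ u12 in (0 : ℝ)..1,
      centralIntegral Φ g u12 u23 * e (-(m2 * u12))) * e (-(m1 * u23)) := by
  rw [period]
  congr 1
  ext u23
  rw [integral_swap, ← intervalIntegral.integral_mul_const]
  · congr 1
    ext u12
    simp only [centralIntegral]
    rw [intervalIntegral.integral_mul_const, mul_assoc, ← e_add]
    congr 2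
    ring
  · exact (h.comp (by fun_prop : Continuous fun p : ℝ × ℝ => p.2) (by fun_prop)
      (by fun_prop)).mul (by fun_prop)


theorem period_finsetSum {ι : Type*} {s : Finset ι} {Φ : ι → Mat → ℂ} {g : Mat}
    (h : ∀ i ∈ s, IsContinuousAlong (Φ i) g) (m1 m2 : ℤ) :
    period (fun x => ∑ i ∈ s, Φ i x) m1 m2 g = ∑ i ∈ s, period (Φ i) m1 m2 g := by
  rw [period_eq_integral_centralIntegral (IsContinuousAlong.finsetSum h)]
  simp only [centralIntegral_finsetSum h]
  have h12 (u23 : ℝ) := integral_sum_mul (k := fun x => e (-(m2 * x))) s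
    (fun i hi => continuous_centralIntegral (h i hi) continuous_id (continuous_const (y := u23)))
    (by fun_prop)
  simp only [id_eq] at h12
  simp only [h12]
  rw [integral_sum_mul s _ (by fun_prop)]
  · exact Finset.sum_congr rfl fun i hi => (period_eq_integral_centralIntegral (h i hi) m1 m2).symm
  · intro i hi
    exact intervalIntegral.continuous_parametric_intervalIntegral_of_continuous'
      (f := fun w v => centralIntegral (Φ i) g v w * e (-(m2 * v)))
      ((continuous_centralIntegral (h i hi) (by fun_prop : Continuous fun p : ℝ × ℝ => p.2)
        (by fun_prop)).mul (by fun_prop)) 0 1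

theorem period_const_mul (r : ℂ) (Φ : Mat → ℂ) (m1 m2 : ℤ) (g : Mat) :
    period (fun x => r * Φ x) m1 m2 g = r * period Φ m1 m2 g := by
  simp only [period, mul_assoc, intervalIntegral.integral_const_mul]

theorem periodic_upper13 {Φ : Mat → ℂ} (hΦ : IsAutomorphicFunction Φ) {g : Mat}
    (hg : g.det ≠ 0) (a c : ℝ) : Function.Periodic (fun x => Φ (upper a x c * g)) 1 :=
  fun x => hΦ.upper13_add_one hg a x c

theorem periodic_centralIntegral_left {Φ : Mat → ℂ} (hΦ : IsAutomorphicFunction Φ) {g : Mat}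
    (hg : g.det ≠ 0) (c : ℝ) : Function.Periodic (fun a => centralIntegral Φ g a c) 1 := by
  intro a
  simp only [centralIntegral]
  -- Translating `u₁₂` by an integral matrix also moves `u₁₃` by `u₂₃`; the integral absorbs this.
  rw [← integral_comp_add_of_periodic (periodic_upper13 hΦ hg (a + 1) c) c]
  simp only [hΦ.upper12_add_one hg]

theorem periodic_centralIntegral_right {Φ : Mat → ℂ} (hΦ : IsAutomorphicFunction Φ) {g : Mat}
    (hg : g.det ≠ 0) (a : ℝ) : Function.Periodic (fun c => centralIntegral Φ g a c) 1 := by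
  intro c
  simp only [centralIntegral, hΦ.upper23_add_one hg]

/-! ### Hecke operators and periods -/

/-- The part of the Hecke operator `T_{abc}` belonging to the diagonal `(a, b, c)`, without the
normalizing factor. -/
def heckePart (a b c : ℕ) (Φ : Mat → ℂ) (g : Mat) : ℂ :=
  ∑ b1 ∈ Finset.range b, ∑ c1 ∈ Finset.range c, ∑ c2 ∈ Finset.range c,
    Φ (!![(a : ℝ), (b1 : ℝ), (c1 : ℝ); 0, (b : ℝ), (c2 : ℝ); 0, 0, (c : ℝ)] * g)

theorem hecke_eq_sum_heckePart (n : ℕ) (Φ : Mat → ℂ) (g : Mat) :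
    hecke n Φ g = ∑ p ∈ n.divisorsAntidiagonal, ∑ q ∈ p.2.divisorsAntidiagonal,
      1 / (n : ℂ) * heckePart p.1 q.1 q.2 Φ g := by
  simp only [← Finset.mul_sum]
  rfl

/-- Moving an upper triangular matrix past a unipotent one. -/
theorem triangular_mul_upper (a b1 c1 c2 : ℝ) {b c : ℝ} (hb : b ≠ 0) (hc : c ≠ 0)
    (u12 u13 u23 : ℝ) (g : Mat) :
    !![a, b1, c1; 0, b, c2; 0, 0, c] * (upper u12 u13 u23 * g) =
      upper ((a * u12 + b1) / b) ((a * u13 + b1 * u23 + c1) / c) ((b * u23 + c2) / c) *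
        (Matrix.diagonal ![a, b, c] * g) := by
  rw [← mul_assoc, ← mul_assoc]
  congr 1
  ext i j
  fin_cases i <;> fin_cases j <;>
    simp [upper, Matrix.mul_apply, Fin.sum_univ_three, Matrix.diagonal] <;> field_simp

theorem heckePart_upper_mul {a b c : ℕ} (hb : b ≠ 0) (hc : c ≠ 0) (Φ : Mat → ℂ)
    (u12 u13 u23 : ℝ) (g : Mat) :
    heckePart a b c Φ (upper u12 u13 u23 * g) =
      ∑ c2 ∈ Finset.range c, ∑ b1 ∈ Finset.range b, ∑ c1 ∈ Finset.range c,
        Φ (upper ((a * u12 + b1) / b) ((a * u13 + b1 * u23 + c1) / c) ((b * u23 + c2) / c) *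
          (Matrix.diagonal ![(a : ℝ), (b : ℝ), (c : ℝ)] * g)) := by
  simp only [heckePart, triangular_mul_upper _ _ _ _ (Nat.cast_ne_zero.2 hb : (b : ℝ) ≠ 0)
    (Nat.cast_ne_zero.2 hc : (c : ℝ) ≠ 0)]
  rw [Finset.sum_comm (s := Finset.range c)]
  exact Finset.sum_congr rfl fun b1 _ => Finset.sum_comm

theorem det_diagonal_mul_ne_zero {a b c : ℕ} (ha : a ≠ 0) (hb : b ≠ 0) (hc : c ≠ 0) {g : Mat}
    (hg : g.det ≠ 0) : (Matrix.diagonal ![(a : ℝ), (b : ℝ), (c : ℝ)] * g).det ≠ 0 := by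
  rw [Matrix.det_mul, Matrix.det_diagonal, Fin.prod_univ_three]
  simp [ha, hb, hc, hg]

theorem isContinuousAlong_heckePart {Φ : Mat → ℂ} (hΦ : IsAutomorphicFunction Φ) {g : Mat}
    (hg : g.det ≠ 0) {a b c : ℕ} (ha : a ≠ 0) (hb : b ≠ 0) (hc : c ≠ 0) :
    IsContinuousAlong (heckePart a b c Φ) g := by
  unfold IsContinuousAlong
  simp only [heckePart_upper_mul hb hc]
  refine continuous_finsetSum _ fun c2 _ => continuous_finsetSum _ fun b1 _ =>
    continuous_finsetSum _ fun c1 _ => ?_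
  exact hΦ.continuous_upper (det_diagonal_mul_ne_zero ha hb hc hg) (by fun_prop) (by fun_prop)
    (by fun_prop)

theorem centralIntegral_heckePart {Φ : Mat → ℂ} (hΦ : IsAutomorphicFunction Φ) {g : Mat}
    (hg : g.det ≠ 0) {a b c : ℕ} (ha : a ≠ 0) (hb : b ≠ 0) (hc : c ≠ 0) (u12 u23 : ℝ) :
    centralIntegral (heckePart a b c Φ) g u12 u23 =
      c * ∑ c2 ∈ Finset.range c, ∑ b1 ∈ Finset.range b,
        centralIntegral Φ (Matrix.diagonal ![(a : ℝ), (b : ℝ), (c : ℝ)] * g)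
          ((a * u12 + b1) / b) ((b * u23 + c2) / c) := by
  have hD := det_diagonal_mul_ne_zero ha hb hc hg
  rw [centralIntegral]
  simp only [heckePart_upper_mul hb hc]
  set g' : Mat := Matrix.diagonal ![(a : ℝ), (b : ℝ), (c : ℝ)] * g
  have hcont (x y s : ℝ) (j : ℕ) :
      Continuous fun t : ℝ => Φ (upper x ((a * t + s + j) / c) y * g') :=
    hΦ.continuous_upper hD (by fun_prop) (by fun_prop) (by fun_prop)
  rw [intervalIntegral.integral_finsetSum (fun c2 _ => (continuous_finsetSum _ fun b1 _ =>
    continuous_finsetSum _ fun c1 _ => hcont _ _ _ _).intervalIntegrable _ _), Finset.mul_sum]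
  refine Finset.sum_congr rfl fun c2 _ => ?_
  rw [intervalIntegral.integral_finsetSum (fun b1 _ =>
    (continuous_finsetSum _ fun c1 _ => hcont _ _ _ _).intervalIntegrable _ _), Finset.mul_sum]
  refine Finset.sum_congr rfl fun b1 _ => ?_
  rw [intervalIntegral.integral_finsetSum (fun c1 _ => (hcont _ _ _ _).intervalIntegrable _ _)]
  exact sum_integral_comp_div
    (hΦ.continuous_upper hD continuous_const continuous_id continuous_const)
    (periodic_upper13 hΦ hD _ _) ha hc (b1 * u23)

/-- Only the diagonal `(1, 1, c)` contributes to the first Fourier-Whittaker period of a Hecke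
translate. -/
theorem period_heckePart {Φ : Mat → ℂ} (hΦ : IsAutomorphicFunction Φ) {g : Mat}
    (hg : g.det ≠ 0) {a b c : ℕ} (ha : a ≠ 0) (hb : b ≠ 0) (hc : c ≠ 0) :
    period (heckePart a b c Φ) 1 1 g =
      if a = 1 ∧ b = 1 then
        c ^ 2 * period Φ c 1 (Matrix.diagonal ![(1 : ℝ), 1, (c : ℝ)] * g) else 0 := by
  have hD := det_diagonal_mul_ne_zero ha hb hc hg
  rw [period_eq_integral_centralIntegral (isContinuousAlong_heckePart hΦ hg ha hb hc)]
  simp only [centralIntegral_heckePart hΦ hg ha hb hc, Int.cast_one, one_mul]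
  set g' : Mat := Matrix.diagonal ![(a : ℝ), (b : ℝ), (c : ℝ)] * g with hg'
  have hΦ' := hΦ.isContinuousAlong hD
  set Y : ℝ → ℂ := fun w =>
    ∫ v in (0 : ℝ)..1, centralIntegral Φ g' v w * e (-((b : ℝ) * v)) with hY
  have h12 (u23 : ℝ) : ∫ u12 in (0 : ℝ)..1, (c * ∑ c2 ∈ Finset.range c, ∑ b1 ∈ Finset.range b,
        centralIntegral Φ g' ((a * u12 + b1) / b) ((b * u23 + c2) / c)) * e (-u12) =
      if a = 1 then c * b * ∑ c2 ∈ Finset.range c, Y ((b * u23 + c2) / c) else 0 := by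
    have hcont (y : ℝ) (j : ℕ) : Continuous fun t : ℝ => centralIntegral Φ g' ((a * t + j) / b) y :=
      continuous_centralIntegral hΦ' (by fun_prop) (by fun_prop)
    simp only [mul_assoc, intervalIntegral.integral_const_mul]
    rw [integral_sum_mul _ (fun c2 _ => continuous_finsetSum _ fun b1 _ => hcont _ _) (by fun_prop)]
    have hs (y : ℝ) := sum_integral_comp_div_mul_e
      (continuous_centralIntegral hΦ' continuous_id (continuous_const (y := y)))
      (periodic_centralIntegral_left hΦ hD y) ha hb
    simp only [integral_sum_mul _ (fun b1 _ => hcont _ b1)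
      (by fun_prop : Continuous fun x => e (-x))]
    simp only [id_eq] at hs
    simp only [hs]
    split_ifs
    · simp only [hY, Finset.mul_sum]
    · simp
  simp only [h12]
  by_cases ha1 : a = 1
  swap
  · simp [ha1]
  simp only [ha1, if_true, true_and]
  have hYc : Continuous Y :=
    intervalIntegral.continuous_parametric_intervalIntegral_of_continuous'
      (f := fun w v => centralIntegral Φ g' v w * e (-((b : ℝ) * v)))
      ((continuous_centralIntegral hΦ' (by fun_prop : Continuous fun p : ℝ × ℝ => p.2)
        (by fun_prop)).mul (by fun_prop)) 0 1
  have hYp : Function.Periodic Y 1 := fun w => by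
    simp only [hY, periodic_centralIntegral_right hΦ hD _ w]
  simp only [mul_assoc, intervalIntegral.integral_const_mul]
  have hYj (j : ℕ) : Continuous fun t : ℝ => Y ((b * t + j) / c) := hYc.comp (by fun_prop)
  rw [integral_sum_mul _ (fun c2 _ => hYj c2) (by fun_prop),
    sum_integral_comp_div_mul_e hYc hYp hb hc]
  split_ifs with hb1
  · have : g' = Matrix.diagonal ![(1 : ℝ), 1, (c : ℝ)] * g := by simp [hg', ha1, hb1]
    rw [← this, period_eq_integral_centralIntegral hΦ']
    simp only [hY, hb1]
    push_cast
    ring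
  · simp

/-- The first period of `T_n Φ` is, up to normalization, the period `(n, 1)` of `Φ`. -/
theorem period_hecke {Φ : Mat → ℂ} (hΦ : IsAutomorphicFunction Φ) {g : Mat}
    (hg : g.det ≠ 0) {n : ℕ} (hn : n ≠ 0) :
    period (hecke n Φ) 1 1 g =
      n * period Φ n 1 (Matrix.diagonal ![(1 : ℝ), 1, (n : ℝ)] * g) := by
  have hn' : (n : ℂ) ≠ 0 := by exact_mod_cast hn
  have hcont : ∀ p ∈ n.divisorsAntidiagonal, ∀ q ∈ p.2.divisorsAntidiagonal,
      p.1 ≠ 0 ∧ q.1 ≠ 0 ∧ q.2 ≠ 0 := by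
    intro p hp q hq
    have h2 := Nat.mem_divisorsAntidiagonal.1 hq
    have h1 := Nat.mem_divisorsAntidiagonal.1 hp
    refine ⟨?_, ?_, ?_⟩ <;> intro h0 <;> simp_all
  have hpart : ∀ p ∈ n.divisorsAntidiagonal, ∀ q ∈ p.2.divisorsAntidiagonal,
      IsContinuousAlong (fun x => 1 / (n : ℂ) * heckePart p.1 q.1 q.2 Φ x) g := by
    intro p hp q hq
    obtain ⟨h1, h2, h3⟩ := hcont p hp q hq
    exact continuous_const.mul (isContinuousAlong_heckePart hΦ hg h1 h2 h3)
  have hfun : hecke n Φ = fun x => ∑ p ∈ n.divisorsAntidiagonal,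
      ∑ q ∈ p.2.divisorsAntidiagonal, 1 / (n : ℂ) * heckePart p.1 q.1 q.2 Φ x :=
    funext (hecke_eq_sum_heckePart n Φ)
  have hval : ∀ p ∈ n.divisorsAntidiagonal, ∀ q ∈ p.2.divisorsAntidiagonal,
      period (fun x => 1 / (n : ℂ) * heckePart p.1 q.1 q.2 Φ x) 1 1 g =
        if p.1 = 1 ∧ q.1 = 1 then n * period Φ n 1 (Matrix.diagonal ![(1 : ℝ), 1, (n : ℝ)] * g)
        else 0 := by
    intro p hp q hq
    obtain ⟨h1, h2, h3⟩ := hcont p hp q hq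
    rw [period_const_mul, period_heckePart hΦ hg h1 h2 h3]
    split_ifs with h
    · have hq2 : q.2 = n := by
        have e2 := (Nat.mem_divisorsAntidiagonal.1 hq).1
        have e1 := (Nat.mem_divisorsAntidiagonal.1 hp).1
        rw [h.2, one_mul] at e2
        rw [h.1, one_mul] at e1
        omega
      rw [hq2]
      field_simp
    · simp
  have h1n : (1, n) ∈ n.divisorsAntidiagonal := by simp [hn]
  rw [hfun, period_finsetSum fun p hp => IsContinuousAlong.finsetSum (hpart p hp),
    Finset.sum_eq_single_of_mem _ h1n, period_finsetSum (hpart _ h1n),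
    Finset.sum_eq_single_of_mem _ h1n, hval _ h1n _ h1n]
  · simp
  · intro q hq hne
    rw [hval _ h1n q hq, if_neg]
    rintro ⟨-, h⟩
    have := (Nat.mem_divisorsAntidiagonal.1 hq).1
    rw [h, one_mul] at this
    exact hne (Prod.ext h this)
  · intro p hp hne
    rw [period_finsetSum (hpart p hp)]
    refine Finset.sum_eq_zero fun q hq => ?_
    rw [hval p hp q hq, if_neg]
    rintro ⟨h, -⟩
    have := (Nat.mem_divisorsAntidiagonal.1 hp).1
    rw [h, one_mul] at this
    exact hne (Prod.ext h this)

/-! ### Transformation rules for periods -/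

theorem integral_comp_neg_of_periodic {f : ℝ → ℂ} (hf : Function.Periodic f 1) :
    ∫ x in (0 : ℝ)..1, f (-x) = ∫ x in (0 : ℝ)..1, f x := by
  rw [intervalIntegral.integral_comp_neg (fun x => f x)]
  simpa using hf.intervalIntegral_add_eq (-1) 0

theorem period_upper23_mul {Φ : Mat → ℂ} (hΦ : IsAutomorphicFunction Φ) {g : Mat}
    (hg : g.det ≠ 0) (m1 m2 : ℤ) (x : ℝ) :
    period Φ m1 m2 (upper 0 0 x * g) = e (m1 * x) * period Φ m1 m2 g := by
  have hc (u12 u23 : ℝ) : centralIntegral Φ (upper 0 0 x * g) u12 u23 =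
      centralIntegral Φ g u12 (u23 + x) := by
    simp only [centralIntegral, ← mul_assoc, upper_mul_upper, add_zero]
    exact integral_comp_add_of_periodic (periodic_upper13 hΦ hg u12 (u23 + x)) (u12 * x)
  rw [period_eq_integral_centralIntegral
      (hΦ.isContinuousAlong (det_upper_mul_ne_zero 0 0 x hg)),
    period_eq_integral_centralIntegral (hΦ.isContinuousAlong hg)]
  simp only [hc]
  refine integral_comp_add_mul_e (f := fun u23 => ∫ u12 in (0 : ℝ)..1,
    centralIntegral Φ g u12 u23 * e (-(m2 * u12))) (fun w => ?_) m1 x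
  simp only [periodic_centralIntegral_right hΦ hg _ w]

theorem period_smul_mul_orthogonal {Φ : Mat → ℂ} (hΦ : IsAutomorphicFunction Φ) {g k : Mat}
    (hg : g.det ≠ 0) (hk : k ∈ Matrix.orthogonalGroup (Fin 3) ℝ) {r : ℝ} (hr : r ≠ 0)
    (m1 m2 : ℤ) : period Φ m1 m2 (r • (g * k)) = period Φ m1 m2 g := by
  have hkd : k.det ≠ 0 := by
    intro h
    have := congrArg Matrix.det ((Matrix.mem_orthogonalGroup_iff (Fin 3) ℝ).1 hk)
    simp [Matrix.det_mul, h] at this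
  have hpt (a b c : ℝ) : Φ (upper a b c * (r • (g * k))) = Φ (upper a b c * g) := by
    have hu := det_upper_mul_ne_zero a b c hg
    rw [Matrix.mul_smul, ← mul_assoc, hΦ.scalar_inv r _ hr (by
      rw [Matrix.det_mul]; exact mul_ne_zero hu hkd), hΦ.right_orthogonal _ k hu hk]
  simp only [period, hpt]

/-- Conjugation by `diag(-1, -1, 1)` shows that the sign of `m₁` does not affect the period
on diagonal matrices. -/
theorem period_neg_torus {Φ : Mat → ℂ} (hΦ : IsAutomorphicFunction Φ) {y0 y1 : ℝ}
    (h0 : 0 < y0) (h1 : 0 < y1) (m1 m2 : ℤ) :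
    period Φ (-m1) m2 (torus y0 y1) = period Φ m1 m2 (torus y0 y1) := by
  have hg := det_torus_ne_zero h0 h1
  have hs : (!![-1, 0, 0; 0, -1, 0; 0, 0, 1] : Mat) ∈ Matrix.orthogonalGroup (Fin 3) ℝ := by
    rw [Matrix.mem_orthogonalGroup_iff]
    ext i j
    fin_cases i <;> fin_cases j <;>
      simp [Matrix.mul_apply, Fin.sum_univ_three]
  have hpt (a b c : ℝ) :
      Φ (upper a b c * torus y0 y1) = Φ (upper a (-b) (-c) * torus y0 y1) := by
    have hd := det_upper_mul_ne_zero a b c hg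
    rw [← hΦ.right_orthogonal _ _ hd hs]
    rw [← hΦ.left_inv ⟨!![-1, 0, 0; 0, -1, 0; 0, 0, 1], by simp [Matrix.det_fin_three]⟩ _ (by
      rw [Matrix.det_mul]
      refine mul_ne_zero hd ?_
      simp [Matrix.det_fin_three])]
    congr 1
    have hmap : (!![-1, 0, 0; 0, -1, 0; 0, 0, 1] : Matrix (Fin 3) (Fin 3) ℤ).map
        (fun n : ℤ => (n : ℝ)) = !![-1, 0, 0; 0, -1, 0; 0, 0, 1] := by
      ext i j
      fin_cases i <;> fin_cases j <;> simp
    have hu : (!![-1, 0, 0; 0, -1, 0; 0, 0, 1] : Mat) * upper a b c =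
        upper a (-b) (-c) * !![-1, 0, 0; 0, -1, 0; 0, 0, 1] := by
      ext i j
      fin_cases i <;> fin_cases j <;> simp [upper, Matrix.mul_apply, Fin.sum_univ_three]
    have ht : (!![-1, 0, 0; 0, -1, 0; 0, 0, 1] : Mat) *
        (torus y0 y1 * !![-1, 0, 0; 0, -1, 0; 0, 0, 1]) = torus y0 y1 := by
      ext i j
      fin_cases i <;> fin_cases j <;> simp [torus, Matrix.mul_apply, Fin.sum_univ_three]
    rw [hmap, mul_assoc (upper a b c), ← mul_assoc, hu, mul_assoc, ht]
  have hc (u12 u23 : ℝ) : centralIntegral Φ (torus y0 y1) u12 u23 =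
      centralIntegral Φ (torus y0 y1) u12 (-u23) := by
    rw [centralIntegral, centralIntegral,
      ← integral_comp_neg_of_periodic (periodic_upper13 hΦ hg u12 (-u23))]
    exact congrArg (fun f : ℝ → ℂ => ∫ x in (0 : ℝ)..1, f x) (funext fun x => hpt u12 x u23)
  rw [period_eq_integral_centralIntegral (hΦ.isContinuousAlong hg),
    period_eq_integral_centralIntegral (hΦ.isContinuousAlong hg)]
  have hp : Function.Periodic (fun u23 => (∫ u12 in (0 : ℝ)..1,
      centralIntegral Φ (torus y0 y1) u12 u23 * e (-(m2 * u12))) * e (-(m1 * u23))) 1 := fun w => by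
    simp only [periodic_centralIntegral_right hΦ hg _ w, e_periodic_int]
  rw [← integral_comp_neg_of_periodic hp]
  congr 1
  ext u23
  simp only [← hc _ u23]
  congr 2
  push_cast
  ring

/-- The periods with `m₁ = 0` contain the integral over the unipotent radical of the parabolic
subgroup of type `(2,1)`, and so vanish for cusp forms. -/
theorem period_zero_left {Φ : Mat → ℂ} (hΦ : IsAutomorphicFunction Φ) (hc : IsCuspidal Φ)
    {g : Mat} (hg : g.det ≠ 0) (m2 : ℤ) : period Φ 0 m2 g = 0 := by
  have hcont := hΦ.isContinuousAlong hg
  rw [period_eq_integral_centralIntegral hcont]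
  simp only [Int.cast_zero, zero_mul, neg_zero, e_zero, mul_one]
  rw [integral_swap]
  · simp only [intervalIntegral.integral_mul_const]
    have h0 (u12 : ℝ) : ∫ u23 in (0 : ℝ)..1, centralIntegral Φ g u12 u23 = 0 := by
      have := (hc (upper u12 0 0 * g) (det_upper_mul_ne_zero _ _ _ hg)).1
      simpa only [← mul_assoc, upper_mul_upper, zero_add, add_zero, zero_mul] using! this
    simp [h0]
  · exact (continuous_centralIntegral hcont (by fun_prop : Continuous fun p : ℝ × ℝ => p.2)
      (by fun_prop)).mul (by fun_prop)

/-- The Iwasawa decomposition of the translate of a diagonal matrix by `lower32 (-a)`. -/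
theorem lower32_mul_torus {y0 : ℝ} (y1 a : ℝ) :
    ∃ k ∈ Matrix.orthogonalGroup (Fin 3) ℝ,
      lower32 (-a) * torus y0 y1 = Real.sqrt (1 + (a * y0) ^ 2) •
        ((upper 0 0 (-(a * y0 ^ 2 / (1 + (a * y0) ^ 2))) *
          torus (y0 / (1 + (a * y0) ^ 2)) (y1 * Real.sqrt (1 + (a * y0) ^ 2))) * k) := by
  have hD : 0 < 1 + (a * y0) ^ 2 := by positivity
  obtain ⟨s, hs, hs2⟩ : ∃ s : ℝ, 0 < s ∧ s ^ 2 = 1 + (a * y0) ^ 2 :=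
    ⟨_, Real.sqrt_pos.2 hD, Real.sq_sqrt hD.le⟩
  have hsq : Real.sqrt (1 + (a * y0) ^ 2) = s := by rw [← hs2, Real.sqrt_sq hs.le]
  rw [hsq]
  have hs0 := hs.ne'
  refine ⟨!![1, 0, 0; 0, 1 / s, a * y0 / s; 0, -(a * y0) / s, 1 / s], ?_, ?_⟩
  · rw [Matrix.mem_orthogonalGroup_iff]
    ext i j
    fin_cases i <;> fin_cases j <;>
      simp [Matrix.mul_apply, Fin.sum_univ_three] <;>
      field_simp <;> linarith
  · rw [← hs2]
    ext i j
    fin_cases i <;> fin_cases j <;>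
      simp [upper, torus, lower32, Matrix.mul_apply, Fin.sum_univ_three] <;>
      field_simp
    · linear_combination y0 * hs2
    · simp

/-! ### Fourier coefficients of Hecke eigenforms -/

/-- The defining property of the coefficients `(a, 1)` holds: the Hecke eigenvalue equation
expresses the period `(n, 1)` through the period `(1, 1)`, and the latter is the Whittaker
function because the first coefficient is nonzero. -/
theorem isFourierCoeff_maassFourierCoeff {Φ : Mat → ℂ} {α : Fin 3 → ℂ}
    (hΦ : IsAutomorphicFunction Φ) (hH : IsHeckeNormalized Φ α) {a : ℤ} (ha : a ≠ 0) :
    IsFourierCoeff Φ α a 1 (maassFourierCoeff Φ α a 1) := by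
  have spec (m1 m2 : ℤ) (h : ∃ b, IsFourierCoeff Φ α m1 m2 b) :
      IsFourierCoeff Φ α m1 m2 (maassFourierCoeff Φ α m1 m2) := by
    rw [maassFourierCoeff, dif_pos h]
    exact h.choose_spec
  have h11 : ∃ b, IsFourierCoeff Φ α 1 1 b := by
    -- Otherwise the first coefficient would take the default value `0`.
    by_contra h
    have := hH.2
    rw [maassFourierCoeff, dif_neg h] at this
    exact zero_ne_one this
  have hW : ∀ y0 y1 : ℝ, 0 < y0 → 0 < y1 →
      period Φ 1 1 (torus y0 y1) = whittaker α y0 y1 := by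
    intro y0 y1 h0 h1
    have := spec 1 1 h11 y0 y1 h0 h1
    rw [hH.2] at this
    simpa using this
  refine spec a 1 ?_
  obtain ⟨n, hn⟩ : ∃ n : ℕ, n = a.natAbs := ⟨_, rfl⟩
  have hn0 : n ≠ 0 := by omega
  have hnR : (n : ℝ) ≠ 0 := by exact_mod_cast hn0
  have hnC : (n : ℂ) ≠ 0 := by exact_mod_cast hn0
  have habs : |(a : ℝ)| = n := by rw [hn, Nat.cast_natAbs]; simp
  obtain ⟨lam, hlam⟩ := hH.1 n (by omega)
  refine ⟨lam, fun y0 y1 h0 h1 => ?_⟩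
  have hny : 0 < (n : ℝ) * y0 := by positivity
  have hsign : period Φ a 1 (torus y0 y1) = period Φ n 1 (torus y0 y1) := by
    rcases Int.natAbs_eq a with h | h
    · rw [h, hn]
    · rw [h, ← hn, period_neg_torus hΦ h0 h1]
  have hdiag : Matrix.diagonal ![(1 : ℝ), 1, (n : ℝ)] * torus (n * y0) y1 =
      (n : ℝ) • (torus y0 y1 * 1) := by
    ext i j
    fin_cases i <;> fin_cases j <;>
      simp [torus, Matrix.diagonal, Matrix.mul_apply, mul_assoc]
  have hT := period_hecke hΦ (det_torus_ne_zero hny h1) hn0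
  rw [hdiag, period_smul_mul_orthogonal hΦ (det_torus_ne_zero h0 h1) (one_mem _) hnR] at hT
  have hE : period (hecke n Φ) 1 1 (torus (n * y0) y1) = lam * whittaker α (n * y0) y1 := by
    rw [← hW _ _ hny h1, ← period_const_mul]
    simp only [period]
    simp only [hlam _ (det_upper_mul_ne_zero _ _ _ (det_torus_ne_zero hny h1))]
  rw [hsign]
  simp only [Int.cast_one, mul_one, abs_one, one_mul, habs]
  rw [hE] at hT
  push_cast
  rw [div_mul_eq_mul_div, hT, mul_div_cancel_left₀ _ hnC]

/-- The terms of the expansion, expressed through the Whittaker function. -/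
theorem period_lower32_eq_offDiagonalTerm {Φ : Mat → ℂ} {α : Fin 3 → ℂ}
    (hΦ : IsAutomorphicFunction Φ) (hH : IsHeckeNormalized Φ α) {y0 y1 : ℝ} (h0 : 0 < y0)
    (h1 : 0 < y1) (a0 : ℤ) {a1 : ℤ} (ha : a1 ≠ 0) :
    period Φ a1 1 (lower32 (-(a0 : ℝ)) * torus y0 y1) = offDiagonalTerm Φ α y0 y1 a0 a1 := by
  have hD : 0 < 1 + ((a0 : ℝ) * y0) ^ 2 := by positivity
  have hs := Real.sqrt_pos.2 hD
  have h0' : 0 < y0 / (1 + ((a0 : ℝ) * y0) ^ 2) := by positivity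
  have h1' : 0 < y1 * Real.sqrt (1 + ((a0 : ℝ) * y0) ^ 2) := by positivity
  have hg := det_torus_ne_zero h0' h1'
  obtain ⟨k, hk, heq⟩ := lower32_mul_torus (y0 := y0) y1 a0
  rw [heq, period_smul_mul_orthogonal hΦ (det_upper_mul_ne_zero _ _ _ hg) hk hs.ne',
    period_upper23_mul hΦ hg, isFourierCoeff_maassFourierCoeff hΦ hH ha _ _ h0' h1',
    offDiagonalTerm, mul_comm (e _)]
  simp only [Int.cast_one, mul_one, abs_one, one_mul]
  congr 2
  · rw [mul_div_assoc]
  · ring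

theorem offDiagonalTerm_zero (Φ : Mat → ℂ) (α : Fin 3 → ℂ) (y0 y1 : ℝ) (a1 : ℤ) :
    offDiagonalTerm Φ α y0 y1 0 a1 = diagonalTerm Φ α y0 y1 a1 := by
  simp [offDiagonalTerm, diagonalTerm, e_zero]

/-- A sum over the integers of a function vanishing at `0` is a sum over nonzero integers. -/
theorem hasSum_nonzero {f : ℤ → ℂ} {s : ℂ} (hf : HasSum f s) (h0 : f 0 = 0) :
    HasSum (fun a : {a : ℤ // a ≠ 0} => f a) s := by
  refine (hasSum_subtype_iff_of_support_subset (s := {a : ℤ | a ≠ 0}) (f := f) ?_).2 hf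
  intro a ha h
  exact ha (h ▸ h0)

/-- The expansion for Hecke-normalized cusp forms: the terms with `a₁ = 0` vanish, and the terms
with `a₀ = 0` form the first sum. -/
theorem incompleteIntegral_eq_of_isHeckeNormalized {Φ : Mat → ℂ} {α : Fin 3 → ℂ}
    (hΦ : IsMaassCuspForm Φ α) (hH : IsHeckeNormalized Φ α) {y0 y1 : ℝ} (h0 : 0 < y0)
    (h1 : 0 < y1) :
    (Summable fun a1 : {a : ℤ // a ≠ 0} => diagonalTerm Φ α y0 y1 a1) ∧
    (∀ a0 : {a : ℤ // a ≠ 0},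
      Summable fun a1 : {a : ℤ // a ≠ 0} => offDiagonalTerm Φ α y0 y1 a0 a1) ∧
    (Summable fun a0 : {a : ℤ // a ≠ 0} =>
      ∑' a1 : {a : ℤ // a ≠ 0}, offDiagonalTerm Φ α y0 y1 a0 a1) ∧
    incompleteIntegral Φ y0 y1 =
      (∑' a1 : {a : ℤ // a ≠ 0}, diagonalTerm Φ α y0 y1 a1) +
        ∑' a0 : {a : ℤ // a ≠ 0}, ∑' a1 : {a : ℤ // a ≠ 0},
          offDiagonalTerm Φ α y0 y1 a0 a1 := by
  have hA := hΦ.automorphic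
  have hinner (a0 : ℤ) : HasSum (fun a1 : {a : ℤ // a ≠ 0} => offDiagonalTerm Φ α y0 y1 a0 a1)
      (∑' a1 : ℤ, period Φ a1 1 (lower32 (-(a0 : ℝ)) * torus y0 y1)) := by
    have hg := det_lower32_mul_ne_zero (-(a0 : ℝ)) (det_torus_ne_zero h0 h1)
    have := hasSum_nonzero (hasSum_period hA hg).summable.hasSum
      (period_zero_left hA hΦ.cuspidal hg 1)
    convert this using 2 with a
    exact (period_lower32_eq_offDiagonalTerm hA hH h0 h1 a0 a.2).symm
  have houter := hasSum_tsum_period hA h0 h1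
  simp only [← (hinner _).tsum_eq] at houter
  have hzero := hinner 0
  simp only [offDiagonalTerm_zero] at hzero
  refine ⟨hzero.summable, fun a0 => (hinner a0).summable, houter.summable.subtype _, ?_⟩
  rw [← houter.tsum_eq, houter.summable.tsum_eq_add_tsum_ite 0]
  congr 1
  · simp only [offDiagonalTerm_zero]
  · rw [← tsum_subtype_eq_of_support_subset (s := {a : ℤ | a ≠ 0})]
    · exact tsum_congr fun a => if_neg a.2
    · intro a ha h
      exact ha (if_pos h)

end GL3

end

theorem mainTheorem5 :
    (∀ Φ : GL3.Mat → ℂ, GL3.IsAutomorphicFunction Φ →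
      ∀ y0 y1 : ℝ, 0 < y0 → 0 < y1 →
        (∀ a0 : ℤ, Summable fun a1 : ℤ =>
          GL3.period Φ a1 1 (GL3.lower32 (-(a0 : ℝ)) * GL3.torus y0 y1)) ∧
        HasSum
          (fun a0 : ℤ => ∑' a1 : ℤ,
            GL3.period Φ a1 1 (GL3.lower32 (-(a0 : ℝ)) * GL3.torus y0 y1))
          (GL3.incompleteIntegral Φ y0 y1)) ∧
    (∀ (Φ : GL3.Mat → ℂ) (α : Fin 3 → ℂ),
      GL3.IsMaassCuspForm Φ α → GL3.IsHeckeNormalized Φ α →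
      ∀ y0 y1 : ℝ, 0 < y0 → 0 < y1 →
        (Summable fun a1 : {a : ℤ // a ≠ 0} => GL3.diagonalTerm Φ α y0 y1 a1) ∧
        (∀ a0 : {a : ℤ // a ≠ 0},
          Summable fun a1 : {a : ℤ // a ≠ 0} => GL3.offDiagonalTerm Φ α y0 y1 a0 a1) ∧
        (Summable fun a0 : {a : ℤ // a ≠ 0} =>
          ∑' a1 : {a : ℤ // a ≠ 0}, GL3.offDiagonalTerm Φ α y0 y1 a0 a1) ∧
        GL3.incompleteIntegral Φ y0 y1 =
          (∑' a1 : {a : ℤ // a ≠ 0}, GL3.diagonalTerm Φ α y0 y1 a1) +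
            ∑' a0 : {a : ℤ // a ≠ 0}, ∑' a1 : {a : ℤ // a ≠ 0},
              GL3.offDiagonalTerm Φ α y0 y1 a0 a1) := by
  refine ⟨fun Φ hΦ y0 y1 h0 h1 => ⟨fun a0 => ?_, GL3.hasSum_tsum_period hΦ h0 h1⟩,
    fun Φ α hΦ hH y0 y1 h0 h1 => GL3.incompleteIntegral_eq_of_isHeckeNormalized hΦ hH h0 h1⟩
  exact (GL3.hasSum_period hΦ (GL3.det_lower32_mul_ne_zero _
    (GL3.det_torus_ne_zero h0 h1))).summable
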